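/- Let $\mathcal C_2$ be the comb: the graph with vertex set $\mathbb Z^2$ in which $(x,y)$ and $(x',y')$ are adjacent if and only if either $x=x'$ and $|y-y'|=1$, or $y=y'=0$ and $|x-x'|=1$. A rotor sequence assigns to every vertex $v$ a cyclic ordering $(v_0,\dots,v_{d(v)-1})$ of its neighbours, where $d(v)$ is the degree of $v$, and a rotor configuration $\rho$ assigns to every vertex $v$ one of its neighbours $\rho(v)$. A particle performing a rotor-router walk and located at $v$ with $\rho(v)=v_i$ first resets $\rho(v)$ to $v_{i+1}$ (indices modulo $d(v)$) and then moves to $v_{i+1}$. In rotor-router aggregation, particles start one after another at the origin $o=(0,0)$; each performs a rotor-router walk until it first reaches a vertex that is not yet occupied, where it stops and which it occupies, and the rotors are not reset between particles. The first particle occupies $o$. The set $R_n$ of vertices occupied by the first $n$ particles is the rotor-router cluster; it depends on the rotor sequence and on the initial rotor configuration. **Theorem.** Let $k=\left(\tfrac32\right)^{2/3}$ and $l=\tfrac12\left(\tfrac32\right)^{1/3}$. There are constants $c_1,c_2,c_3>0$ and $n_0\in\mathbb N$ such that for every $n\ge n_0$, every rotor sequence and every initial rotor configuration on $\mathcal C_2$,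 $$\Big\{(x,y)\in\mathbb Z^2:\ |x|\le k\,n^{1/3}-c_1 n^{1/6},\quad |y|\le l\Big(n^{1/3}-\frac{|x|}{k}\Big)^2+c_2|x|-c_3 n^{1/3}\Big\}\subseteq R_n .$$ -/

import Mathlib

noncomputable section

namespace RotorRouter

/-- A rotor sequence on `G`: for every vertex `v` an enumeration
`c(v) = (v_0, …, v_{d(v)-1})` of its neighbours, where `d(v)` is the degree of `v`. -/
abbrev RotorSequence {V : Type*} (G : SimpleGraph V) : Type _ :=
  ∀ v : V, Fin (Nat.card (G.neighborSet v)) ≃ G.neighborSet v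

/-- A rotor configuration on `G` assigns to every vertex one of its neighbours. -/
abbrev RotorConfig {V : Type*} (G : SimpleGraph V) : Type _ :=
  ∀ v : V, G.neighborSet v

/-- The neighbour of `v` that follows `w` in the cyclic order `c(v)`: `v_i` is sent to `v_{i+1}`,
with `i + 1` taken modulo `d(v)` (`finRotate d` is the map `i ↦ i + 1 mod d` on `Fin d`). -/
def nextNeighbor {V : Type*} {G : SimpleGraph V} (c : RotorSequence G) (v : V)
    (w : G.neighborSet v) : G.neighborSet v :=
  c v (finRotate _ ((c v).symm w))

open Classical in
/-- One step of a rotor-router walk. The state is the position `v` of the particle together with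
the current rotor configuration. First the rotor at `v` is moved to the next neighbour, then the
particle moves to the neighbour the rotor is now pointing at. -/
def walkStep {V : Type*} {G : SimpleGraph V} (c : RotorSequence G)
    (s : V × RotorConfig G) : V × RotorConfig G :=
  ((nextNeighbor c s.1 (s.2 s.1) : V),
    Function.update s.2 s.1 (nextNeighbor c s.1 (s.2 s.1)))

/-- The number of steps after which the rotor-router walk started in the state `s` is outside of
`A` for the first time. (On an infinite connected locally finite graph the walk leaves every
finite set `A`; otherwise the infimum of the empty set is `0`.) -/
def exitTime {V : Type*} {G : SimpleGraph V} (c : RotorSequence G) (A : Set V)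
    (s : V × RotorConfig G) : ℕ :=
  sInf {t : ℕ | ((walkStep c)^[t] s).1 ∉ A}

/-- The state of a particle started at `o`, with rotors `ρ`, at the moment it first leaves `A`:
its position and the rotor configuration it leaves behind. -/
def exitState {V : Type*} {G : SimpleGraph V} (c : RotorSequence G) (o : V) (A : Set V)
    (ρ : RotorConfig G) : V × RotorConfig G :=
  (walkStep c)^[exitTime c A (o, ρ)] (o, ρ)

/-- Rotor-router aggregation at `o` with initial rotors `ρ₀`: the set of occupied sites and the
rotor configuration after `n` particles. Each particle starts at `o` and stops at the first vertex
that is not yet occupied; the rotors are not reset. The first particle stops at `o` at once. -/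
def aggregation {V : Type*} {G : SimpleGraph V} (c : RotorSequence G) (o : V)
    (ρ₀ : RotorConfig G) : ℕ → Set V × RotorConfig G
  | 0 => (∅, ρ₀)
  | n + 1 =>
    (insert (exitState c o (aggregation c o ρ₀ n).1 (aggregation c o ρ₀ n).2).1
        (aggregation c o ρ₀ n).1,
      (exitState c o (aggregation c o ρ₀ n).1 (aggregation c o ρ₀ n).2).2)

/-- The rotor-router cluster `R_n` of `n` particles. -/
def cluster {V : Type*} {G : SimpleGraph V} (c : RotorSequence G) (o : V)
    (ρ₀ : RotorConfig G) (n : ℕ) : Set V :=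
  (aggregation c o ρ₀ n).1

/-- The comb `C_2` on the vertex set `ℤ × ℤ`: all vertical edges of the square lattice, and those
horizontal edges that lie on the `x`-axis. -/
def comb : SimpleGraph (ℤ × ℤ) where
  Adj p q := (p.1 = q.1 ∧ |p.2 - q.2| = 1) ∨ (p.2 = 0 ∧ q.2 = 0 ∧ |p.1 - q.1| = 1)
  symm := ⟨by
    rintro p q (⟨h, h'⟩ | ⟨h, h', h''⟩)
    · exact Or.inl ⟨h.symm, by rw [abs_sub_comm]; exact h'⟩
    · exact Or.inr ⟨h', h, by rw [abs_sub_comm]; exact h''⟩⟩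
  loopless := ⟨by
    rintro p (⟨_, h⟩ | ⟨_, _, h⟩) <;> simp at h⟩

/-- The constant `k = (3/2)^(2/3)`. -/
def k : ℝ := (3 / 2 : ℝ) ^ (2 / 3 : ℝ)

/-- The constant `l = (1/2) (3/2)^(1/3)`. -/
def l : ℝ := (1 / 2 : ℝ) * (3 / 2 : ℝ) ^ (1 / 3 : ℝ)

/-- The set of points `(x, y)` of the comb with `|x| ≤ k n^(1/3) - c₁ n^(1/6)` and
`|y| ≤ l (n^(1/3) - |x|/k)^2 + c₂ |x| - c₃ n^(1/3)`. -/
def innerRegion (c₁ c₂ c₃ : ℝ) (n : ℕ) : Set (ℤ × ℤ) :=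
  {z | |(z.1 : ℝ)| ≤ k * (n : ℝ) ^ (1 / 3 : ℝ) - c₁ * (n : ℝ) ^ (1 / 6 : ℝ) ∧
    |(z.2 : ℝ)| ≤ l * ((n : ℝ) ^ (1 / 3 : ℝ) - |(z.1 : ℝ)| / k) ^ 2
      + c₂ * |(z.1 : ℝ)| - c₃ * (n : ℝ) ^ (1 / 3 : ℝ)}

end RotorRouter

end

/-!
Between two particles every vertex has sent almost equally many particles to each of its
neighbours: the counts differ by at most one. Every edge of the comb is a bridge, so the net
number of particles that have crossed it away from the origin is the number of occupied sites
beyond it. On a tooth of height `h` these two facts make the number of particles that have entered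
it equal to `h ^ 2 / 2`, up to an error linear in `h`. Along the backbone they give a discrete
version of `a'' = 2 √(2 a)` for the number `a` of crossings, up to bounded errors. Comparison with
explicit barriers shows that at distance `t` from the tip of the cluster `a` is about
`t ^ 4 / 18`, the teeth have height about `t ^ 2 / 3`, and about `2 t ^ 3 / 9` sites lie beyond.
The crossings from the origin to the left and to the right differ by at most one, so the two
halves of the backbone have nearly the same length `r`, and `4 r ^ 3 / 9 = n` puts both tips at
`k n ^ (1 / 3)`, up to a bounded error.
-/

namespace RotorRouter

section General

variable {V : Type*} {G : SimpleGraph V} {c : RotorSequence G} {ρ₀ : RotorConfig G}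

open Classical in
/-- The number of passages from `v` to `w` when the rotors start at `ρ₀` and every vertex `x` has
been left `u x` times. The `t`-th departure from `v` follows the rotor turned `t` times, so the
odometer `u` determines all passages. -/
noncomputable def crossings (c : RotorSequence G) (ρ₀ : RotorConfig G) (u : V → ℕ) (v w : V) : ℕ :=
  Nat.count (fun t ↦ ((nextNeighbor c v)^[t + 1] (ρ₀ v) : V) = w) (u v)

theorem crossings_eq_zero {u : V → ℕ} {v : V} (h : u v = 0) (w : V) :
    crossings c ρ₀ u v w = 0 := by
  rw [crossings, h, Nat.count_zero]

theorem crossings_add_single [DecidableEq V] (u : V → ℕ) (x v w : V) :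
    crossings c ρ₀ (u + Pi.single x 1) v w = crossings c ρ₀ u v w +
      if v = x ∧ w = (nextNeighbor c x)^[u x + 1] (ρ₀ x) then 1 else 0 := by
  obtain rfl | hv := eq_or_ne v x
  · simp [crossings, Nat.count_succ, eq_comm]
  · simp only [crossings, Pi.add_apply, Pi.single_eq_of_ne hv, hv, false_and, if_false, add_zero]

theorem symm_nextNeighbor (c : RotorSequence G) (v : V) (w : G.neighborSet v) :
    ((c v).symm (nextNeighbor c v w) : ℕ) = ((c v).symm w + 1) % Nat.card (G.neighborSet v) := by
  rw [nextNeighbor, Equiv.symm_apply_apply]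
  generalize (c v).symm w = i
  generalize Nat.card (G.neighborSet v) = d at i
  cases d with
  | zero => exact i.elim0
  | succ d => simp [finRotate_apply, Fin.val_add]

theorem symm_nextNeighbor_iterate (c : RotorSequence G) (v : V) (w : G.neighborSet v) (t : ℕ) :
    ((c v).symm ((nextNeighbor c v)^[t] w) : ℕ) =
      ((c v).symm w + t) % Nat.card (G.neighborSet v) := by
  induction t with
  | zero => exact (Nat.mod_eq_of_lt ((c v).symm w).isLt).symm
  | succ t ih =>
    rw [Function.iterate_succ_apply', symm_nextNeighbor, ih, Nat.mod_add_mod, add_assoc]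

theorem exists_nextNeighbor_iterate_succ_eq_iff (c : RotorSequence G) (v : V)
    (w w' : G.neighborSet v) :
    ∃ a : ℕ, ∀ t, (nextNeighbor c v)^[t + 1] w = w' ↔ t ≡ a [MOD Nat.card (G.neighborSet v)] := by
  set i : ℕ := ((c v).symm w).val
  set d := Nat.card (G.neighborSet v)
  have hi : i + 1 ≤ d := ((c v).symm w).isLt
  refine ⟨(c v).symm w' + (d - (i + 1)), fun t ↦ ?_⟩
  calc (nextNeighbor c v)^[t + 1] w = w'
      ↔ i + (t + 1) ≡ (c v).symm w' [MOD d] := by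
        rw [← (c v).symm.injective.eq_iff, Fin.ext_iff, symm_nextNeighbor_iterate,
          Nat.ModEq, Nat.mod_eq_of_lt ((c v).symm w').isLt]
    _ ↔ t + (i + 1) ≡ (c v).symm w' + (d - (i + 1)) + (i + 1) [MOD d] := by
        rw [add_assoc _ (d - (i + 1)), Nat.sub_add_cancel hi, Nat.ModEq, Nat.ModEq,
          Nat.add_mod_right, add_left_comm, add_comm i]
    _ ↔ t ≡ (c v).symm w' + (d - (i + 1)) [MOD d] :=
        ⟨Nat.ModEq.add_right_cancel' _, Nat.ModEq.add_right _⟩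

theorem div_le_crossings_le {v w : V} (u : V → ℕ) (hw : G.Adj v w) :
    u v / Nat.card (G.neighborSet v) ≤ crossings c ρ₀ u v w ∧
      crossings c ρ₀ u v w ≤ u v / Nat.card (G.neighborSet v) + 1 := by
  classical
  obtain ⟨a, ha⟩ := exists_nextNeighbor_iterate_succ_eq_iff c v (ρ₀ v) ⟨w, hw⟩
  have hd : 0 < Nat.card (G.neighborSet v) := ((c v).symm (ρ₀ v)).pos
  have hcount : crossings c ρ₀ u v w =
      Nat.count (· ≡ a [MOD Nat.card (G.neighborSet v)]) (u v) := by
    simp only [crossings, ← ha, Subtype.ext_iff]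
  rw [hcount, Nat.count_modEq_card _ hd]
  split_ifs <;> omega

theorem crossings_le_crossings_add_one {u : V → ℕ} {v w w' : V} (hw : G.Adj v w)
    (hw' : G.Adj v w') : crossings c ρ₀ u v w ≤ crossings c ρ₀ u v w' + 1 := by
  have := (div_le_crossings_le (c := c) (ρ₀ := ρ₀) u hw).2
  have := (div_le_crossings_le (c := c) (ρ₀ := ρ₀) u hw').1
  omega

theorem le_degree_mul_crossings_add_one {v w : V} (u : V → ℕ) (hw : G.Adj v w) :
    u v ≤ Nat.card (G.neighborSet v) * (crossings c ρ₀ u v w + 1) := by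
  have hd : 0 < Nat.card (G.neighborSet v) := ((c v).symm (ρ₀ v)).pos
  have hlt := (Nat.div_lt_iff_lt_mul hd).1
    (Nat.lt_succ_of_le (div_le_crossings_le (c := c) (ρ₀ := ρ₀) u hw).1)
  rw [mul_comm]
  exact hlt.le

/-- The edge from `p` to `q` leads into the set `B`, and no other edge does. -/
structure IsOnlyEntrance (G : SimpleGraph V) (B : Set V) (p q : V) : Prop where
  adj : G.Adj p q
  notMem : p ∉ B
  mem : q ∈ B
  unique : ∀ ⦃v w⦄, G.Adj v w → v ∉ B → w ∈ B → v = p ∧ w = q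

/-- A path `p 0, p 1, …` leading away from `o` such that the edge from `p j` to `p (j + 1)` is the
only entrance of the set `B j` of the vertices beyond `p j`. Along such rays the net flow of
particles is the number of occupied sites ahead. -/
structure IsRay (G : SimpleGraph V) (o : V) (p : ℕ → V) (B : ℕ → Set V) : Prop where
  origin_notMem : ∀ j, o ∉ B j
  entrance : ∀ j, IsOnlyEntrance G (B j) (p j) (p (j + 1))

theorem IsRay.reachable {o : V} {p : ℕ → V} {B : ℕ → Set V} (hp : IsRay G o p B) (j : ℕ) :
    G.Reachable (p 0) (p j) := by
  induction j with
  | zero => exact .rfl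
  | succ j ih => exact ih.trans (hp.entrance j).adj.reachable

variable [DecidableEq V]

/-- `Attained c o ρ₀ A s u` holds if, at some moment of the rotor-router aggregation at `o` with
initial rotors `ρ₀`, the set `A` is occupied, the current particle and the rotors are in the state
`s`, and every vertex `v` has been left `u v` times so far. -/
inductive Attained (c : RotorSequence G) (o : V) (ρ₀ : RotorConfig G) :
    Finset V → V × RotorConfig G → (V → ℕ) → Prop
  | start : Attained c o ρ₀ ∅ (o, ρ₀) 0
  | step {A s u} : Attained c o ρ₀ A s u → s.1 ∈ A →
      Attained c o ρ₀ A (walkStep c s) (u + Pi.single s.1 1)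
  | settle {A s u} : Attained c o ρ₀ A s u → s.1 ∉ A →
      Attained c o ρ₀ (insert s.1 A) (o, s.2) u

variable {o : V} {A : Finset V} {s : V × RotorConfig G} {u : V → ℕ}

namespace Attained

theorem rotor_eq (h : Attained c o ρ₀ A s u) (v : V) :
    s.2 v = (nextNeighbor c v)^[u v] (ρ₀ v) := by
  induction h with
  | start => rfl
  | @step _ s _ _ _ ih =>
    obtain rfl | hv := eq_or_ne v s.1
    · simp only [walkStep, Function.update_self, Pi.add_apply, Pi.single_eq_same,
        Function.iterate_succ_apply', ih]
    · rw [Pi.add_apply, Pi.single_eq_of_ne hv, add_zero, ← ih]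
      simp [walkStep, hv]
  | settle _ _ ih => exact ih

theorem odometer_eq_zero (h : Attained c o ρ₀ A s u) {v : V} (hv : v ∉ A) : u v = 0 := by
  induction h with
  | start => rfl
  | @step A s u _ hs ih =>
    have hvs : v ≠ s.1 := fun h ↦ hv (h ▸ hs)
    rw [Pi.add_apply, Pi.single_eq_of_ne hvs, ih hv, add_zero]
  | settle _ _ ih => exact ih fun h ↦ hv (Finset.mem_insert_of_mem h)

theorem crossings_walkStep (h : Attained c o ρ₀ A s u) (v w : V) :
    crossings c ρ₀ (u + Pi.single s.1 1) v w =
      crossings c ρ₀ u v w + if v = s.1 ∧ w = (walkStep c s).1 then 1 else 0 := by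
  rw [crossings_add_single, walkStep, h.rotor_eq s.1, Function.iterate_succ_apply']

theorem crossings_le_odometer_add (h : Attained c o ρ₀ A s u) (v w : V) :
    crossings c ρ₀ u v w ≤ u w + (if w ∈ A then 1 else 0) + if s.1 = w then 1 else 0 := by
  induction h with
  | start => simp [crossings_eq_zero]
  | @step A s u h hs ih =>
    have hsingle : (Pi.single s.1 1 : V → ℕ) w = if s.1 = w then 1 else 0 := by
      simp [Pi.single_apply, eq_comm]
    rw [h.crossings_walkStep, Pi.add_apply, hsingle]
    grind
  | @settle A s u _ hs ih => grind

theorem mem_or_eq_empty (h : Attained c o ρ₀ A s u) : A = ∅ ∧ s.1 = o ∨ o ∈ A := by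
  induction h with
  | start => exact .inl ⟨rfl, rfl⟩
  | step _ hs ih => exact ih.imp_left fun h ↦ by simp [h.1] at hs
  | settle _ _ ih =>
    rcases ih with ⟨-, hs⟩ | ho
    · exact .inr (hs ▸ Finset.mem_insert_self _ _)
    · exact .inr (Finset.mem_insert_of_mem ho)

theorem crossings_eq_crossings_add (h : Attained c o ρ₀ A s u) {B : Set V}
    [DecidablePred (· ∈ B)] {p q : V} (hB : IsOnlyEntrance G B p q) (ho : o ∉ B) :
    crossings c ρ₀ u p q =
      crossings c ρ₀ u q p + {v ∈ A | v ∈ B}.card + if s.1 ∈ B then 1 else 0 := by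
  induction h with
  | start => simp [crossings_eq_zero, ho]
  | @step A s u h _ ih =>
    have hadj : G.Adj s.1 (walkStep c s).1 := (nextNeighbor c s.1 (s.2 s.1)).2
    have hin := hB.unique hadj
    have hout := hB.unique hadj.symm
    have hp := hB.notMem
    have hq := hB.mem
    rw [h.crossings_walkStep, h.crossings_walkStep]
    grind
  | @settle A s u _ hs ih =>
    rw [Finset.filter_insert, if_neg ho]
    split_ifs at ih ⊢ <;> simp [hs, ih, add_assoc]

theorem exists_odometer_le (hG : G.Preconnected) (hA : ∃ v, v ∉ A) (v : V) :
    ∃ K, ∀ s u, Attained c o ρ₀ A s u → u v ≤ K := by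
  obtain ⟨z, hz⟩ := hA
  obtain ⟨walk⟩ := hG v z
  induction walk with
  | nil => exact ⟨0, fun s u h ↦ (h.odometer_eq_zero hz).le⟩
  | @cons v w _ hvw _ ih =>
    obtain ⟨K, hK⟩ := ih hz
    refine ⟨Nat.card (G.neighborSet v) * (K + 3), fun s u h ↦ ?_⟩
    have hcross : crossings c ρ₀ u v w ≤ K + 2 := by
      have := h.crossings_le_odometer_add v w
      have := hK s u h
      split_ifs at * <;> omega
    calc u v ≤ Nat.card (G.neighborSet v) * (crossings c ρ₀ u v w + 1) :=
          le_degree_mul_crossings_add_one u hvw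
      _ ≤ Nat.card (G.neighborSet v) * (K + 3) := Nat.mul_le_mul_left _ (by omega)

theorem exists_iterate (h : Attained c o ρ₀ A s u) (t : ℕ)
    (ht : ∀ t' < t, ((walkStep c)^[t'] s).1 ∈ A) :
    ∃ u', Attained c o ρ₀ A ((walkStep c)^[t] s) u' ∧ ∑ v ∈ A, u' v = ∑ v ∈ A, u v + t := by
  induction t with
  | zero => exact ⟨u, h, rfl⟩
  | succ t ih =>
    obtain ⟨u', h', hsum⟩ := ih fun t' ht' ↦ ht t' (by omega)
    have hmem := ht t (by omega)
    rw [Function.iterate_succ_apply']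
    refine ⟨_, h'.step hmem, ?_⟩
    simp only [Pi.add_apply, Finset.sum_add_distrib, hsum, Finset.sum_pi_single', hmem, if_true,
      add_assoc]

theorem exists_exit (hG : G.Preconnected) (hA : ∃ v, v ∉ A) (h : Attained c o ρ₀ A s u) :
    ∃ t, ((walkStep c)^[t] s).1 ∉ A := by
  by_contra! hstay
  choose K hK using exists_odometer_le (c := c) (o := o) (ρ₀ := ρ₀) hG hA
  obtain ⟨u', h', hsum⟩ := h.exists_iterate (∑ v ∈ A, K v + 1) fun t _ ↦ hstay t
  have : ∑ v ∈ A, u' v ≤ ∑ v ∈ A, K v := Finset.sum_le_sum fun v _ ↦ hK v _ _ h'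
  omega

theorem settle_exitState (hG : G.Preconnected) (hA : ∃ v, v ∉ A) {ρ : RotorConfig G}
    (h : Attained c o ρ₀ A (o, ρ) u) :
    (exitState c o A ρ).1 ∉ A ∧ ∃ u', Attained c o ρ₀ (insert (exitState c o A ρ).1 A)
      (o, (exitState c o A ρ).2) u' := by
  have hexit : (exitState c o A ρ).1 ∉ A :=
    Nat.sInf_mem (s := {t | ((walkStep c)^[t] (o, ρ)).1 ∉ A}) (h.exists_exit hG hA)
  obtain ⟨u', h', -⟩ := h.exists_iterate (exitTime c A (o, ρ)) fun t ht ↦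
    not_not.1 (Nat.notMem_of_lt_sInf ht)
  exact ⟨hexit, u', h'.settle hexit⟩

end Attained

theorem exists_attained_cluster [Infinite V] (hG : G.Preconnected) (c : RotorSequence G) (o : V)
    (ρ₀ : RotorConfig G) (n : ℕ) :
    ∃ (A : Finset V) (u : V → ℕ), cluster c o ρ₀ n = A ∧ A.card = n ∧
      Attained c o ρ₀ A (o, (aggregation c o ρ₀ n).2) u := by
  induction n with
  | zero => exact ⟨∅, 0, by simp [cluster, aggregation], rfl, .start⟩
  | succ n ih =>
    obtain ⟨A, u, hA, hcard, h⟩ := ih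
    obtain ⟨hexit, u', h'⟩ := h.settle_exitState hG (Infinite.exists_notMem_finset A)
    have hocc : (aggregation c o ρ₀ n).1 = A := hA
    exact ⟨insert (exitState c o A (aggregation c o ρ₀ n).2).1 A, u',
      by rw [cluster, aggregation, Finset.coe_insert, hocc],
      by rw [Finset.card_insert_of_notMem hexit, hcard], by rwa [aggregation, hocc]⟩

namespace IsRay

variable {p : ℕ → V} {B : ℕ → Set V} [∀ j, DecidablePred (· ∈ B j)] {ρ : RotorConfig G}

theorem crossings_eq (hp : IsRay G o p B) (h : Attained c o ρ₀ A (o, ρ) u) (j : ℕ) :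
    crossings c ρ₀ u (p j) (p (j + 1)) =
      crossings c ρ₀ u (p (j + 1)) (p j) + {v ∈ A | v ∈ B j}.card := by
  simpa only [hp.origin_notMem, if_false, add_zero] using
    h.crossings_eq_crossings_add (hp.entrance j) (hp.origin_notMem j)

theorem crossings_le (hp : IsRay G o p B) (h : Attained c o ρ₀ A (o, ρ) u) (j : ℕ) :
    crossings c ρ₀ u (p j) (p (j + 1)) ≤
      crossings c ρ₀ u (p (j + 1)) (p (j + 2)) + {v ∈ A | v ∈ B j}.card + 1 := by
  have hbalance : crossings c ρ₀ u (p (j + 1)) (p j) ≤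
      crossings c ρ₀ u (p (j + 1)) (p (j + 2)) + 1 :=
    crossings_le_crossings_add_one (hp.entrance j).adj.symm (hp.entrance (j + 1)).adj
  have := hp.crossings_eq h j
  omega

theorem le_crossings (hp : IsRay G o p B) (h : Attained c o ρ₀ A (o, ρ) u) (j : ℕ) :
    crossings c ρ₀ u (p (j + 1)) (p (j + 2)) + {v ∈ A | v ∈ B j}.card ≤
      crossings c ρ₀ u (p j) (p (j + 1)) + 1 := by
  have hbalance : crossings c ρ₀ u (p (j + 1)) (p (j + 2)) ≤
      crossings c ρ₀ u (p (j + 1)) (p j) + 1 :=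
    crossings_le_crossings_add_one (hp.entrance (j + 1)).adj (hp.entrance j).adj.symm
  have := hp.crossings_eq h j
  omega

theorem mem_of_card_pos (hp : IsRay G o p B) (h : Attained c o ρ₀ A (o, ρ) u) {j : ℕ}
    (hj : 0 < {v ∈ A | v ∈ B j}.card) : p j ∈ A := by
  by_contra hmem
  have hflow := hp.crossings_eq h j
  rw [crossings_eq_zero (h.odometer_eq_zero hmem)] at hflow
  omega

theorem crossings_eq_zero_of_card_eq_zero (hp : IsRay G o p B)
    (h : Attained c o ρ₀ A (o, ρ) u) {j : ℕ} (hj : {v ∈ A | v ∈ B j}.card = 0) :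
    crossings c ρ₀ u (p j) (p (j + 1)) = 0 := by
  have hmem : p (j + 1) ∉ A := fun hA ↦
    Finset.filter_eq_empty_iff.1 (Finset.card_eq_zero.1 hj) hA (hp.entrance j).mem
  rw [hp.crossings_eq h, hj, crossings_eq_zero (h.odometer_eq_zero hmem)]

theorem card_eq_card_succ_add (hp : IsRay G o p B) (hB : ∀ j, B j = insert (p (j + 1)) (B (j + 1)))
    (A : Finset V) (j : ℕ) :
    {v ∈ A | v ∈ B j}.card =
      {v ∈ A | v ∈ B (j + 1)}.card + if p (j + 1) ∈ A then 1 else 0 := by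
  have hfilter : {v ∈ A | v ∈ B j} =
      {v ∈ A | v = p (j + 1)} ∪ {v ∈ A | v ∈ B (j + 1)} := by
    ext v
    simp only [hB j, Set.mem_insert_iff, Finset.mem_union, Finset.mem_filter, and_or_left]
  have hdisj : Disjoint {v ∈ A | v = p (j + 1)} {v ∈ A | v ∈ B (j + 1)} :=
    Finset.disjoint_filter.2 fun v _ hv ↦ hv ▸ (hp.entrance (j + 1)).notMem
  rw [hfilter, Finset.card_union_of_disjoint hdisj, Finset.filter_eq']
  split_ifs <;> simp [add_comm]

theorem mem_succ_of_card_pos (hp : IsRay G o p B)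
    (hB : ∀ j, B j = insert (p (j + 1)) (B (j + 1))) (h : Attained c o ρ₀ A (o, ρ) u) {j : ℕ}
    (hj : 0 < {v ∈ A | v ∈ B j}.card) : p (j + 1) ∈ A := by
  by_contra hmem
  rw [hp.card_eq_card_succ_add hB, if_neg hmem, add_zero] at hj
  exact hmem (hp.mem_of_card_pos h hj)

theorem mem_of_lt_card (hp : IsRay G o p B) (hB : ∀ j, B j = insert (p (j + 1)) (B (j + 1)))
    (h : Attained c o ρ₀ A (o, ρ) u) {i j : ℕ} (hi : i < {v ∈ A | v ∈ B j}.card) :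
    p (j + i + 1) ∈ A := by
  induction i generalizing j with
  | zero => exact hp.mem_succ_of_card_pos hB h hi
  | succ i ih =>
    have hstep := hp.card_eq_card_succ_add hB A j
    have hnext := ih (j := j + 1) (by split_ifs at hstep <;> omega)
    rwa [add_right_comm j 1 i] at hnext

theorem triangular_bounds (hp : IsRay G o p B) (hB : ∀ j, B j = insert (p (j + 1)) (B (j + 1)))
    (h : Attained c o ρ₀ A (o, ρ) u) {i j : ℕ} (hi : {v ∈ A | v ∈ B j}.card = i) :
    i * (i - 1 : ℤ) ≤ 2 * crossings c ρ₀ u (p j) (p (j + 1)) ∧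
      2 * crossings c ρ₀ u (p j) (p (j + 1)) ≤ i * (i + 3 : ℤ) := by
  induction i generalizing j with
  | zero => simp [hp.crossings_eq_zero_of_card_eq_zero h hi]
  | succ i ih =>
    have hstep := hp.card_eq_card_succ_add hB A j
    rw [if_pos (hp.mem_succ_of_card_pos hB h (by omega))] at hstep
    obtain ⟨hlower, hupper⟩ := ih (j := j + 1) (by omega)
    have hle := hp.crossings_le h j
    have hge := hp.le_crossings h j
    rw [hi] at hle hge
    zify at hle hge
    push_cast
    constructor <;> linarith

end IsRay

end General

section Barriers

theorem comparison_principle {a S T F : ℕ → ℝ} {r : ℕ} (ha : ∀ j, a j ≤ a (j + 1) + S j + 1)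
    (hS : ∀ j, S j ≤ S (j + 1) + T (j + 1))
    (hT : ∀ i j, a j ≤ F (i + 1) → T j ≤ F (i + 2) - 2 * F (i + 1) + F i)
    (har : a r ≤ F 1) (hSr : S r ≤ F 1 - F 0 - 1) {i j : ℕ} (hij : i + j = r) :
    a j ≤ F (i + 1) ∧ S j ≤ F (i + 1) - F i - 1 := by
  induction i generalizing j with
  | zero =>
    obtain rfl : j = r := by omega
    simpa using ⟨har, hSr⟩
  | succ i ih =>
    obtain ⟨hai, hSi⟩ := ih (j := j + 1) (by omega)
    have hTi := hT i (j + 1) hai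
    have := ha j
    have := hS j
    constructor <;> linarith

/-- A supersolution of the equation `a'' = 2 √(2 a)` governing the backbone, whose solution with
zero initial data is `t ^ 4 / 18`; the correction absorbs the bounded discretisation errors. -/
noncomputable def upperBarrier (t : ℝ) : ℝ := t ^ 4 / 18 - t ^ 2 / 2

/-- A subsolution of the equation `a'' = 2 √(2 a)` governing the backbone, whose solution with
zero initial data is `t ^ 4 / 18`; the correction absorbs the bounded discretisation errors. -/
noncomputable def lowerBarrier (t : ℝ) : ℝ := t ^ 4 / 18 + 2 * t ^ 2 / 3 + 2

theorem height_le_of_le_upperBarrier {h a t : ℝ} (ht : 3 ≤ t) (hh : h * (h - 1) ≤ 2 * a + 2)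
    (ha : a ≤ upperBarrier t) : h ≤ t ^ 2 / 3 - 1 := by
  by_contra! hlt
  have : 9 ≤ t ^ 2 := by nlinarith
  have : (t ^ 2 / 3 - 1) * (t ^ 2 / 3 - 2) < h * (h - 1) := by
    apply mul_lt_mul'' <;> linarith
  unfold upperBarrier at ha
  linarith

theorem le_height_of_lowerBarrier_le {h a t : ℝ} (h0 : 0 ≤ h) (hh : 2 * a - 2 ≤ h * (h + 3))
    (ha : lowerBarrier t ≤ a) : t ^ 2 / 3 + 1 / 2 ≤ h := by
  by_contra! hlt
  have : h * (h + 3) < (t ^ 2 / 3 + 1 / 2) * (t ^ 2 / 3 + 7 / 2) := by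
    apply mul_lt_mul'' <;> linarith
  unfold lowerBarrier at ha
  linarith

theorem upperBarrier_bounds {a S T : ℕ → ℝ} {r : ℕ} (ha : ∀ j, a j ≤ a (j + 1) + S j + 1)
    (hS : ∀ j, S j ≤ S (j + 1) + T (j + 1))
    (hT : ∀ j, ∀ t : ℝ, 3 ≤ t → a j ≤ upperBarrier t → T j ≤ 2 / 3 * t ^ 2 - 1)
    (har : a r ≤ 0) (hSr : S r ≤ 0) :
    a 0 ≤ upperBarrier (r + 3) ∧ S 0 ≤ 2 / 9 * (r + 3) ^ 3 := by
  have hbarrier := comparison_principle (F := fun i ↦ upperBarrier (i + 2)) ha hS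
    (fun i j haj ↦ by
      have hi : (3 : ℝ) ≤ i + 3 := by linarith [(i.cast_nonneg : (0 : ℝ) ≤ i)]
      have := hT j (i + 3) hi (haj.trans_eq (by push_cast; ring_nf))
      simp only [upperBarrier]
      push_cast
      linarith)
    (by norm_num [upperBarrier, har]) (by norm_num [upperBarrier]; linarith) (add_zero r)
  obtain ⟨har, hSr⟩ := hbarrier
  simp only [upperBarrier] at har hSr ⊢
  push_cast at har hSr
  exact ⟨by linarith, by nlinarith [(r.cast_nonneg : (0 : ℝ) ≤ r)]⟩

theorem lowerBarrier_le {a S T : ℕ → ℝ} {r : ℕ} (ha0 : ∀ j, 0 ≤ a j)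
    (ha : ∀ j, a (j + 1) + S j ≤ a j + 1) (hS : ∀ j, S (j + 1) + T (j + 1) ≤ S j)
    (hT1 : ∀ j ≤ r, 1 ≤ T j)
    (hT : ∀ j, ∀ t : ℝ, lowerBarrier t ≤ a j → 2 / 3 * t ^ 2 + 2 ≤ T j)
    (hSr : 0 ≤ S r) {i j : ℕ} (hij : i + j + 3 = r) : lowerBarrier i ≤ a j := by
  have hinit : 3 ≤ a (r - 3) ∧ 3 ≤ S (r - 3) := by
    obtain ⟨m, rfl⟩ : ∃ m, r = m + 3 := ⟨i + j, hij.symm⟩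
    have hS2 : 1 ≤ S (m + 2) := by linarith [hS (m + 2), hT1 (m + 3) le_rfl]
    have hS1 : 2 ≤ S (m + 1) := by linarith [hS (m + 1), hT1 (m + 2) (by omega)]
    have hS0 : 3 ≤ S m := by linarith [hS m, hT1 (m + 1) (by omega)]
    have ha1 : 1 ≤ a (m + 1) := by linarith [ha (m + 1), ha0 (m + 2)]
    exact ⟨by simpa using by linarith [ha m], hS0⟩
  have hbarrier := comparison_principle (a := -a) (S := -S) (T := -T)
    (F := fun i ↦ -lowerBarrier (i - 1)) (r := r - 3) (i := i) (j := j)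
    (fun j ↦ by simp only [Pi.neg_apply]; linarith [ha j])
    (fun j ↦ by simp only [Pi.neg_apply]; linarith [hS j])
    (fun i j haj ↦ by
      have := hT j i (by simpa using haj)
      simp only [lowerBarrier, Pi.neg_apply]
      push_cast
      linarith)
    (by norm_num [lowerBarrier]; linarith) (by norm_num [lowerBarrier]; linarith) (by omega)
  simpa using hbarrier.1

end Barriers

section Comb

/-- The vertex at height `j` of the tooth over `x`, on the side of the backbone given by `s`. -/
def tooth (x : ℤ) (s : ℤˣ) (j : ℕ) : ℤ × ℤ := (x, s * j)

/-- The vertex of the backbone at distance `j` from the origin, on the side given by `s`. -/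
def spine (s : ℤˣ) (j : ℕ) : ℤ × ℤ := (s * j, 0)

/-- The part of the comb that `tooth x s j` separates from the backbone. -/
def beyondTooth (x : ℤ) (s : ℤˣ) (j : ℕ) : Set (ℤ × ℤ) := {z | z.1 = x ∧ (j : ℤ) < s * z.2}

/-- The part of the comb that `spine s j` separates from the origin. -/
def beyondSpine (s : ℤˣ) (j : ℕ) : Set (ℤ × ℤ) := {z | (j : ℤ) < s * z.1}

instance (x : ℤ) (s : ℤˣ) (j : ℕ) : DecidablePred (· ∈ beyondTooth x s j) :=
  fun z ↦ inferInstanceAs (Decidable (z.1 = x ∧ (j : ℤ) < s * z.2))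

instance (s : ℤˣ) (j : ℕ) : DecidablePred (· ∈ beyondSpine s j) :=
  fun z ↦ inferInstanceAs (Decidable ((j : ℤ) < s * z.1))

theorem mem_beyondTooth {x : ℤ} {s : ℤˣ} {j : ℕ} {z : ℤ × ℤ} :
    z ∈ beyondTooth x s j ↔ z.1 = x ∧ (j : ℤ) < s * z.2 := Iff.rfl

theorem mem_beyondSpine {s : ℤˣ} {j : ℕ} {z : ℤ × ℤ} :
    z ∈ beyondSpine s j ↔ (j : ℤ) < s * z.1 := Iff.rfl

theorem exists_units_mul_natAbs (y : ℤ) : ∃ s : ℤˣ, y = s * y.natAbs := by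
  obtain h | h := le_total 0 y
  · exact ⟨1, by simp [abs_of_nonneg h]⟩
  · exact ⟨-1, by simp [abs_of_nonpos h]⟩

theorem comb_adj_iff {x y x' y' : ℤ} : comb.Adj (x, y) (x', y') ↔
    (x = x' ∧ (y - y' = 1 ∨ y - y' = -1)) ∨ (y = 0 ∧ y' = 0 ∧ (x - x' = 1 ∨ x - x' = -1)) := by
  simp only [comb, abs_eq (zero_le_one : (0 : ℤ) ≤ 1)]

theorem isRay_tooth (x : ℤ) (s : ℤˣ) : IsRay comb (0, 0) (tooth x s) (beyondTooth x s) where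
  origin_notMem j := by simp [mem_beyondTooth]
  entrance j := by
    constructor
    case unique =>
      rintro ⟨a, b⟩ ⟨a', b'⟩ hadj hv hw
      rw [comb_adj_iff] at hadj
      obtain rfl | rfl := Int.units_eq_one_or s <;>
        simp only [mem_beyondTooth, tooth, Prod.mk.injEq, Units.val_neg,
          Units.val_one] at * <;> omega
    all_goals
      obtain rfl | rfl := Int.units_eq_one_or s <;> simp [tooth, mem_beyondTooth, comb_adj_iff]

theorem isRay_spine (s : ℤˣ) : IsRay comb (0, 0) (spine s) (beyondSpine s) where
  origin_notMem j := by simp [mem_beyondSpine]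
  entrance j := by
    constructor
    case unique =>
      rintro ⟨a, b⟩ ⟨a', b'⟩ hadj hv hw
      rw [comb_adj_iff] at hadj
      obtain rfl | rfl := Int.units_eq_one_or s <;>
        simp only [mem_beyondSpine, spine, Prod.mk.injEq, Units.val_neg,
          Units.val_one] at * <;> omega
    all_goals
      obtain rfl | rfl := Int.units_eq_one_or s <;> simp [spine, mem_beyondSpine, comb_adj_iff]

theorem beyondTooth_eq_insert (x : ℤ) (s : ℤˣ) (j : ℕ) :
    beyondTooth x s j = insert (tooth x s (j + 1)) (beyondTooth x s (j + 1)) := by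
  ext ⟨a, b⟩
  obtain rfl | rfl := Int.units_eq_one_or s <;>
    simp only [mem_beyondTooth, tooth, Set.mem_insert_iff, Prod.mk.injEq,
      Units.val_neg, Units.val_one] <;> omega

theorem comb_preconnected : comb.Preconnected := by
  suffices h : ∀ z, comb.Reachable (0, 0) z from fun z w ↦ (h z).symm.trans (h w)
  rintro ⟨x, y⟩
  obtain ⟨s, hs⟩ := exists_units_mul_natAbs x
  obtain ⟨s', hs'⟩ := exists_units_mul_natAbs y
  have hspine := (isRay_spine s).reachable x.natAbs
  have htooth := (isRay_tooth x s').reachable y.natAbs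
  simp only [spine, tooth, ← hs, ← hs', Nat.cast_zero, mul_zero] at hspine htooth
  exact hspine.trans htooth

/-- The number of sites of `A` on the tooth over `x`, on the side of the backbone given by `s`. -/
def toothHeight (A : Finset (ℤ × ℤ)) (x : ℤ) (s : ℤˣ) : ℕ := {z ∈ A | z ∈ beyondTooth x s 0}.card

/-- The number of sites of `A` with first coordinate `x`. -/
def columnSize (A : Finset (ℤ × ℤ)) (x : ℤ) : ℕ := {z ∈ A | z.1 = x}.card

/-- The number of sites of `A` beyond the backbone vertex `spine s j`. -/
def sideSize (A : Finset (ℤ × ℤ)) (s : ℤˣ) (j : ℕ) : ℕ := {z ∈ A | z ∈ beyondSpine s j}.card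

theorem columnSize_eq_add (A : Finset (ℤ × ℤ)) (x : ℤ) :
    columnSize A x =
      toothHeight A x 1 + toothHeight A x (-1) + if (x, 0) ∈ A then 1 else 0 := by
  simp only [columnSize, toothHeight, Finset.card_filter]
  rw [← Finset.sum_ite_eq' A (x, 0) (fun _ ↦ 1), ← Finset.sum_add_distrib,
    ← Finset.sum_add_distrib]
  refine Finset.sum_congr rfl fun ⟨a, b⟩ _ ↦ ?_
  simp only [mem_beyondTooth, Prod.mk.injEq, Units.val_neg, Units.val_one]
  split_ifs <;> omega

theorem sideSize_eq_add (A : Finset (ℤ × ℤ)) (s : ℤˣ) (j : ℕ) :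
    sideSize A s j = sideSize A s (j + 1) + columnSize A (s * (j + 1 : ℕ)) := by
  simp only [sideSize, columnSize, Finset.card_filter]
  rw [← Finset.sum_add_distrib]
  refine Finset.sum_congr rfl fun ⟨a, b⟩ _ ↦ ?_
  obtain rfl | rfl := Int.units_eq_one_or s <;>
    simp only [mem_beyondSpine, Units.val_neg, Units.val_one] <;>
    split_ifs <;> omega

theorem card_eq_sideSize_add (A : Finset (ℤ × ℤ)) (s : ℤˣ) :
    A.card = sideSize A s 0 + sideSize A (-s) 0 + columnSize A 0 := by
  simp only [sideSize, columnSize, Finset.card_filter, Finset.card_eq_sum_ones A]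
  rw [← Finset.sum_add_distrib, ← Finset.sum_add_distrib]
  refine Finset.sum_congr rfl fun ⟨a, b⟩ _ ↦ ?_
  obtain rfl | rfl := Int.units_eq_one_or s <;>
    simp only [mem_beyondSpine, Units.val_neg, Units.val_one] <;>
    split_ifs <;> omega

theorem exists_sideSize_eq_zero (A : Finset (ℤ × ℤ)) (s : ℤˣ) : ∃ j, sideSize A s j = 0 := by
  refine ⟨∑ z ∈ A, (s * z.1 : ℤ).natAbs,
    Finset.card_eq_zero.2 (Finset.filter_eq_empty_iff.2 fun z hz hlt ↦ ?_)⟩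
  have hle := Finset.single_le_sum (f := fun z : ℤ × ℤ ↦ (s * z.1 : ℤ).natAbs)
    (fun _ _ ↦ Nat.zero_le _) hz
  simp only [mem_beyondSpine] at hlt
  omega

/-- The distance from the origin to the last column on the side `s` that meets `A`. -/
def extent (A : Finset (ℤ × ℤ)) (s : ℤˣ) : ℕ := Nat.find (exists_sideSize_eq_zero A s)

theorem sideSize_extent (A : Finset (ℤ × ℤ)) (s : ℤˣ) : sideSize A s (extent A s) = 0 :=
  Nat.find_spec (exists_sideSize_eq_zero A s)

theorem sideSize_pos_of_lt_extent {A : Finset (ℤ × ℤ)} {s : ℤˣ} {j : ℕ} (hj : j < extent A s) :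
    0 < sideSize A s j :=
  Nat.pos_of_ne_zero (Nat.find_min (exists_sideSize_eq_zero A s) hj)

namespace Attained

variable {c : RotorSequence comb} {ρ₀ ρ : RotorConfig comb} {A : Finset (ℤ × ℤ)}
  {u : ℤ × ℤ → ℕ}

theorem toothHeight_bounds (h : Attained c (0, 0) ρ₀ A ((0, 0), ρ) u) {x : ℤ} {w : ℤ × ℤ}
    (hw : comb.Adj (x, 0) w) (s : ℤˣ) :
    (toothHeight A x s : ℝ) * (toothHeight A x s - 1) ≤ 2 * crossings c ρ₀ u (x, 0) w + 2 ∧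
      2 * (crossings c ρ₀ u (x, 0) w : ℝ) - 2 ≤ toothHeight A x s * (toothHeight A x s + 3) := by
  have hbase : tooth x s 0 = (x, 0) := by simp [tooth]
  have hadj : comb.Adj (x, 0) (tooth x s 1) := hbase ▸ ((isRay_tooth x s).entrance 0).adj
  have hle := crossings_le_crossings_add_one (c := c) (ρ₀ := ρ₀) (u := u) hw hadj
  have hge := crossings_le_crossings_add_one (c := c) (ρ₀ := ρ₀) (u := u) hadj hw
  obtain ⟨hlower, hupper⟩ := (isRay_tooth x s).triangular_bounds (beyondTooth_eq_insert x s) h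
    (j := 0) (i := toothHeight A x s) rfl
  rw [hbase] at hlower hupper
  zify at hle hge
  constructor
  · exact_mod_cast (by linarith : (toothHeight A x s : ℤ) * (toothHeight A x s - 1) ≤
      2 * crossings c ρ₀ u (x, 0) w + 2)
  · exact_mod_cast (by linarith : 2 * (crossings c ρ₀ u (x, 0) w : ℤ) - 2 ≤
      toothHeight A x s * (toothHeight A x s + 3))

theorem columnSize_le (h : Attained c (0, 0) ρ₀ A ((0, 0), ρ) u) {x : ℤ} {w : ℤ × ℤ} {t : ℝ}
    (hw : comb.Adj (x, 0) w) (ht : 3 ≤ t) (hcross : crossings c ρ₀ u (x, 0) w ≤ upperBarrier t) :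
    columnSize A x ≤ 2 / 3 * t ^ 2 - 1 := by
  have hheight (s : ℤˣ) : toothHeight A x s ≤ t ^ 2 / 3 - 1 :=
    height_le_of_le_upperBarrier ht (h.toothHeight_bounds hw s).1 hcross
  have hbase : (if (x, 0) ∈ A then 1 else 0 : ℝ) ≤ 1 := by split_ifs <;> norm_num
  rw [columnSize_eq_add]
  push_cast
  linarith [hheight 1, hheight (-1)]

theorem le_columnSize (h : Attained c (0, 0) ρ₀ A ((0, 0), ρ) u) {x : ℤ} {w : ℤ × ℤ} {t : ℝ}
    (hw : comb.Adj (x, 0) w) (hcross : lowerBarrier t ≤ crossings c ρ₀ u (x, 0) w) :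
    2 / 3 * t ^ 2 + 2 ≤ columnSize A x := by
  have hheight (s : ℤˣ) : t ^ 2 / 3 + 1 / 2 ≤ toothHeight A x s :=
    le_height_of_lowerBarrier_le (Nat.cast_nonneg _) (h.toothHeight_bounds hw s).2 hcross
  have hbase : (x, 0) ∈ A := by
    by_contra hmem
    rw [crossings_eq_zero (h.odometer_eq_zero hmem), Nat.cast_zero, lowerBarrier] at hcross
    linarith [sq_nonneg t, sq_nonneg (t ^ 2)]
  rw [columnSize_eq_add, if_pos hbase]
  push_cast
  linarith [hheight 1, hheight (-1)]

theorem base_mem_of_columnSize_pos (h : Attained c (0, 0) ρ₀ A ((0, 0), ρ) u) {x : ℤ}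
    (hx : 0 < columnSize A x) : (x, 0) ∈ A := by
  have htooth (s : ℤˣ) (hs : 0 < toothHeight A x s) : (x, 0) ∈ A := by
    simpa [tooth] using (isRay_tooth x s).mem_of_card_pos h hs
  rw [columnSize_eq_add] at hx
  by_contra hmem
  rw [if_neg hmem, add_zero, Nat.add_pos_iff_pos_or_pos] at hx
  exact hmem (hx.elim (htooth 1) (htooth (-1)))

theorem spine_mem (h : Attained c (0, 0) ρ₀ A ((0, 0), ρ) u) (hA : A.Nonempty) {s : ℤˣ} {j : ℕ}
    (hj : j ≤ extent A s) : spine s j ∈ A := by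
  obtain hlt | rfl := hj.lt_or_eq
  · exact (isRay_spine s).mem_of_card_pos h (sideSize_pos_of_lt_extent hlt)
  cases hr : extent A s with
  | zero => simpa [spine] using h.mem_or_eq_empty.resolve_left fun hempty ↦ hA.ne_empty hempty.1
  | succ r =>
    have hcolumn := sideSize_eq_add A s r
    rw [← hr, sideSize_extent, zero_add] at hcolumn
    rw [spine, ← hr]
    exact h.base_mem_of_columnSize_pos
      (hcolumn ▸ sideSize_pos_of_lt_extent (hr ▸ r.lt_succ_self))

theorem crossings_le_upperBarrier (h : Attained c (0, 0) ρ₀ A ((0, 0), ρ) u) (s : ℤˣ) :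
    crossings c ρ₀ u (0, 0) (spine s 1) ≤ upperBarrier (extent A s + 3) ∧
      sideSize A s 0 ≤ 2 / 9 * (extent A s + 3 : ℝ) ^ 3 := by
  have hbounds := upperBarrier_bounds
    (a := fun j ↦ crossings c ρ₀ u (spine s j) (spine s (j + 1)))
    (S := fun j ↦ sideSize A s j) (T := fun j ↦ columnSize A (s * j)) (r := extent A s)
    (fun j ↦ by exact_mod_cast (isRay_spine s).crossings_le h j)
    (fun j ↦ by exact_mod_cast (sideSize_eq_add A s j).le)
    (fun j t ↦ h.columnSize_le ((isRay_spine s).entrance j).adj)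
    (by exact_mod_cast
      ((isRay_spine s).crossings_eq_zero_of_card_eq_zero h (sideSize_extent A s)).le)
    (by exact_mod_cast (sideSize_extent A s).le)
  simpa [spine] using hbounds

theorem lowerBarrier_le_crossings (h : Attained c (0, 0) ρ₀ A ((0, 0), ρ) u) (hA : A.Nonempty)
    {s : ℤˣ} {i j : ℕ} (hij : i + j + 3 = extent A s) :
    lowerBarrier i ≤ crossings c ρ₀ u (spine s j) (spine s (j + 1)) := by
  have hcolumn (j : ℕ) (hj : j ≤ extent A s) : 1 ≤ columnSize A (s * j) :=
    Finset.card_pos.2 ⟨spine s j, Finset.mem_filter.2 ⟨h.spine_mem hA hj, rfl⟩⟩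
  exact lowerBarrier_le (a := fun j ↦ crossings c ρ₀ u (spine s j) (spine s (j + 1)))
    (S := fun j ↦ sideSize A s j) (T := fun j ↦ columnSize A (s * j))
    (fun j ↦ Nat.cast_nonneg _)
    (fun j ↦ by exact_mod_cast (isRay_spine s).le_crossings h j)
    (fun j ↦ by exact_mod_cast (sideSize_eq_add A s j).ge)
    (fun j hj ↦ by exact_mod_cast hcolumn j hj)
    (fun j t ↦ h.le_columnSize ((isRay_spine s).entrance j).adj)
    (Nat.cast_nonneg _) hij

theorem extent_le_extent_add (h : Attained c (0, 0) ρ₀ A ((0, 0), ρ) u) (hA : A.Nonempty)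
    (s s' : ℤˣ) : extent A s' ≤ extent A s + 6 := by
  by_contra! hlt
  obtain ⟨i, hi⟩ : ∃ i, i + 0 + 3 = extent A s' := ⟨extent A s' - 3, by omega⟩
  have hadj (s : ℤˣ) : comb.Adj (0, 0) (spine s 1) := by
    simpa [spine] using ((isRay_spine s).entrance 0).adj
  have hbalance : (crossings c ρ₀ u (0, 0) (spine s' 1) : ℝ) ≤
      crossings c ρ₀ u (0, 0) (spine s 1) + 1 := by
    exact_mod_cast crossings_le_crossings_add_one (hadj s') (hadj s)
  have hupper := (h.crossings_le_upperBarrier s).1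
  have hlower : lowerBarrier i ≤ crossings c ρ₀ u (0, 0) (spine s' 1) := by
    simpa [spine] using h.lowerBarrier_le_crossings (j := 0) hA hi
  have hpow : (extent A s + 3 : ℝ) ^ 4 ≤ (i : ℝ) ^ 4 := by
    exact_mod_cast Nat.pow_le_pow_left (by omega) 4
  simp only [upperBarrier, lowerBarrier] at hupper hlower
  linarith [sq_nonneg (i : ℝ), sq_nonneg (extent A s + 3 : ℝ)]

theorem card_le_extent (h : Attained c (0, 0) ρ₀ A ((0, 0), ρ) u) (hA : A.Nonempty) (s : ℤˣ) :
    9 / 4 * (A.card : ℝ) ≤ (extent A s + 9 : ℝ) ^ 3 := by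
  have hr : (0 : ℝ) ≤ extent A s := Nat.cast_nonneg _
  obtain ⟨hcross, hside⟩ := h.crossings_le_upperBarrier s
  have hadj : comb.Adj (0, 0) (spine s 1) := by
    simpa [spine] using ((isRay_spine s).entrance 0).adj
  have hcolumn : columnSize A 0 ≤ 2 / 3 * (extent A s + 3 : ℝ) ^ 2 - 1 :=
    h.columnSize_le hadj (by linarith) hcross
  have hopposite : sideSize A (-s) 0 ≤ 2 / 9 * (extent A s + 9 : ℝ) ^ 3 := by
    have hle : (extent A (-s) + 3 : ℝ) ≤ extent A s + 9 := by
      exact_mod_cast (by have := h.extent_le_extent_add hA s (-s); omega :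
        extent A (-s) + 3 ≤ extent A s + 9)
    exact (h.crossings_le_upperBarrier (-s)).2.trans (by gcongr)
  rw [card_eq_sideSize_add A s]
  push_cast
  nlinarith [pow_nonneg hr 2, pow_nonneg hr 3]

theorem le_toothHeight (h : Attained c (0, 0) ρ₀ A ((0, 0), ρ) u) (hA : A.Nonempty) {s : ℤˣ}
    {i j : ℕ} (hij : i + j + 3 = extent A s) (s' : ℤˣ) :
    (i : ℝ) ^ 2 / 3 + 1 / 2 ≤ toothHeight A (s * j) s' :=
  le_height_of_lowerBarrier_le (Nat.cast_nonneg _)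
    (h.toothHeight_bounds ((isRay_spine s).entrance j).adj s').2
    (h.lowerBarrier_le_crossings hA hij)

theorem tooth_mem (h : Attained c (0, 0) ρ₀ A ((0, 0), ρ) u) (hA : A.Nonempty) {s : ℤˣ}
    {i j : ℕ} (hij : i + j + 3 = extent A s) (s' : ℤˣ) {y : ℕ} (hy : (y : ℝ) ≤ (i : ℝ) ^ 2 / 3) :
    tooth (s * j) s' y ∈ A := by
  cases y with
  | zero => simpa [tooth, spine] using h.spine_mem hA (s := s) (j := j) (by omega)
  | succ y =>
    have hlt : y < toothHeight A (s * j) s' := by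
      have := h.le_toothHeight hA hij s'
      exact_mod_cast (by push_cast at hy; linarith : (y : ℝ) < toothHeight A (s * j) s')
    simpa only [zero_add] using
      (isRay_tooth (s * j) s').mem_of_lt_card (beyondTooth_eq_insert _ _) h hlt

end Attained

end Comb

section Main

theorem k_pos : 0 < k := by unfold k; positivity

theorem k_cube : k ^ 3 = 9 / 4 := by
  rw [k, ← Real.rpow_natCast, ← Real.rpow_mul (by norm_num)]
  norm_num

theorem l_eq : l = k ^ 2 / 3 := by
  rw [k, l, ← Real.rpow_natCast, ← Real.rpow_mul (by norm_num),
    show (2 / 3 : ℝ) * (2 : ℕ) = 1 + 1 / 3 by norm_num, Real.rpow_add (by norm_num), Real.rpow_one]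
  ring

theorem natAbs_snd_le_of_mem_innerRegion {c₁ : ℝ} {n : ℕ} {z : ℤ × ℤ}
    (hz : z ∈ innerRegion c₁ 1 (9 * k) n) :
    (z.2.natAbs : ℝ) ≤ (k * n ^ (1 / 3 : ℝ) - z.1.natAbs) ^ 2 / 3 + z.1.natAbs
      - 9 * (k * n ^ (1 / 3 : ℝ)) := by
  have hy := hz.2
  have hk := k_pos.ne'
  have hparabola (m x : ℝ) : l * (m - x / k) ^ 2 = (k * m - x) ^ 2 / 3 := by
    rw [l_eq]
    field_simp
  rw [hparabola] at hy
  simp only [Nat.cast_natAbs, Int.cast_abs]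
  linarith

theorem lt_sub_and_le_of_le_parabola {R x y : ℝ} (hR : 0 < R) (hx0 : 0 ≤ x) (hxR : x ≤ R)
    (hy0 : 0 ≤ y) (hy : y ≤ (R - x) ^ 2 / 3 + x - 9 * R) :
    12 < R - x ∧ y ≤ (R - x - 12) ^ 2 / 3 := by
  -- With `d = R - x` the bound is `y ≤ d ^ 2 / 3 - 9 * d - 8 * x`, negative if `d ≤ 12`.
  have hfar : 12 < R - x := by
    by_contra! hle
    nlinarith
  exact ⟨hfar, by nlinarith⟩

theorem innerRegion_subset_cluster {c₁ : ℝ} (hc₁ : 0 ≤ c₁) {n : ℕ} (hn : n ≠ 0)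
    (c : RotorSequence comb) (ρ₀ : RotorConfig comb) :
    innerRegion c₁ 1 (9 * k) n ⊆ cluster c (0, 0) ρ₀ n := by
  rintro ⟨x, y⟩ hz
  obtain ⟨A, u, hcluster, hcard, h⟩ := exists_attained_cluster comb_preconnected c (0, 0) ρ₀ n
  have hA : A.Nonempty := Finset.card_ne_zero.1 (hcard ▸ hn)
  obtain ⟨s, hs⟩ := exists_units_mul_natAbs x
  obtain ⟨s', hs'⟩ := exists_units_mul_natAbs y
  have hx : (x.natAbs : ℝ) ≤ k * n ^ (1 / 3 : ℝ) := by
    simpa only [Nat.cast_natAbs, Int.cast_abs] using hz.1.trans (sub_le_self _ (by positivity))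
  have hreach : k * n ^ (1 / 3 : ℝ) ≤ extent A s + 9 := by
    refine le_of_pow_le_pow_left₀ three_ne_zero (by positivity) ?_
    calc (k * (n : ℝ) ^ (1 / 3 : ℝ)) ^ 3 = 9 / 4 * (A.card : ℝ) := by
          rw [mul_pow, k_cube, hcard, ← Real.rpow_mul_natCast n.cast_nonneg]
          norm_num
      _ ≤ (extent A s + 9) ^ 3 := h.card_le_extent hA s
  have hR : 0 < k * (n : ℝ) ^ (1 / 3 : ℝ) :=
    mul_pos k_pos (Real.rpow_pos_of_pos (by exact_mod_cast Nat.pos_of_ne_zero hn) _)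
  obtain ⟨hfar, hy⟩ := lt_sub_and_le_of_le_parabola hR x.natAbs.cast_nonneg hx
    y.natAbs.cast_nonneg (natAbs_snd_le_of_mem_innerRegion hz)
  obtain ⟨i, hi⟩ : ∃ i, i + x.natAbs + 3 = extent A s := by
    have hlt : x.natAbs + 3 < extent A s := by
      exact_mod_cast (by linarith : (x.natAbs : ℝ) + 3 < extent A s)
    exact ⟨extent A s - (x.natAbs + 3), by omega⟩
  have hdepth : k * n ^ (1 / 3 : ℝ) - x.natAbs - 12 ≤ i := by
    have hi' : (i + x.natAbs + 3 : ℝ) = extent A s := by exact_mod_cast hi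
    linarith
  have hmem : tooth (s * x.natAbs) s' y.natAbs ∈ A :=
    h.tooth_mem hA hi s' (hy.trans (by linarith [pow_le_pow_left₀ (by linarith) hdepth 2]))
  rwa [tooth, ← hs, ← hs', ← Finset.mem_coe, ← hcluster] at hmem

end Main

end RotorRouter

theorem theorem5p3 :
    ∃ c₁ c₂ c₃ : ℝ, 0 < c₁ ∧ 0 < c₂ ∧ 0 < c₃ ∧ ∃ n₀ : ℕ, ∀ n : ℕ, n₀ ≤ n →
      ∀ (c : RotorRouter.RotorSequence RotorRouter.comb)
        (ρ₀ : RotorRouter.RotorConfig RotorRouter.comb),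
        RotorRouter.innerRegion c₁ c₂ c₃ n ⊆ RotorRouter.cluster c ((0, 0) : ℤ × ℤ) ρ₀ n := by
  refine ⟨1, 1, 9 * RotorRouter.k, one_pos, one_pos, mul_pos (by norm_num) RotorRouter.k_pos, 1, ?_⟩
  intro n hn c ρ₀
  exact RotorRouter.innerRegion_subset_cluster zero_le_one (by omega) c ρ₀
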